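/- Let $R$ be a commutative Artinian Gorenstein local ring (Gorenstein: $R$ has finite injective dimension as a module over itself). An $R$-module $M$ is called rigid if $\operatorname{Ext}^1_R(M,M)=0$. For an integer $n$ and $R$-modules $M,N$, say that $M$ is an $n$-th syzygy of $N$ if: for $n>0$, there is an exact sequence $0\to M\to F_{n-1}\to\cdots\to F_0\to N\to 0$ with every $F_i$ free of finite rank; for $n=0$, $M\cong N$; for $n=-k<0$, there is an exact sequence $0\to N\to F_0\to\cdots\to F_{k-1}\to M\to 0$ with every $F_i$ free of finite rank (the sequences are not required to be minimal). If $I\subseteq R$ is an ideal, $n\in\mathbb{Z}$, and $M$ is an $R$-module that is an $n$-th syzygy of $I$ and is rigid, then $M$ is free. In particular, the Auslander–Reiten conjecture holds for every ideal of $R$: if $I\subseteq R$ is an ideal with $\operatorname{Ext}^i_R(I,I\oplus R)=0$ for all $i>0$, then $I$ is projective. -/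

import Mathlib

universe u

/-- A Gorenstein local ring: a (commutative) Noetherian local ring having finite injective
dimension as a module over itself. -/
class IsGorensteinLocalRing (R : Type u) [CommRing R] : Prop
    extends IsLocalRing R, IsNoetherianRing R where
  exists_hasInjectiveDimensionLE :
    ∃ d : ℕ, CategoryTheory.HasInjectiveDimensionLE (ModuleCat.of R R) d

/-- An `R`-module `M` is rigid if `Ext¹_R(M, M) = 0`. -/
def IsRigidModule (R : Type u) [CommRing R] (M : Type u) [AddCommGroup M] [Module R M] : Prop :=
  Subsingleton (CategoryTheory.Abelian.Ext.{u} (ModuleCat.of R M) (ModuleCat.of R M) 1)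

/-- `M` is a first syzygy of `N`: there is a short exact sequence `0 → M → R^m → N → 0`. -/
def IsFirstSyzygy (R : Type u) [CommRing R] (M N : Type u) [AddCommGroup M] [Module R M]
    [AddCommGroup N] [Module R N] : Prop :=
  ∃ (m : ℕ) (f : M →ₗ[R] (Fin m → R)) (g : (Fin m → R) →ₗ[R] N),
    Function.Injective f ∧ Function.Exact f g ∧ Function.Surjective g

/-- `M` is an `n`-th syzygy of `N`, for a natural number `n`: by splicing the short exact
sequences, there is an exact sequence `0 → M → Fₙ₋₁ → ⋯ → F₀ → N → 0` with the `Fᵢ` free of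
finite rank. The resolution is not required to be minimal. -/
def IsNthSyzygy (R : Type u) [CommRing R] : ℕ → ModuleCat.{u} R → ModuleCat.{u} R → Prop
  | 0, M, N => Nonempty (M ≃ₗ[R] N)
  | n + 1, M, N => ∃ K : ModuleCat.{u} R, IsFirstSyzygy R M K ∧ IsNthSyzygy R n K N

/-- `M` is an `n`-th syzygy of `N`, for an integer `n`. For `n = -k < 0` there is an exact
sequence `0 → N → F₀ → ⋯ → Fₖ₋₁ → M → 0` with the `Fᵢ` free of finite rank; that is,
`N` is a `k`-th syzygy of `M`. -/
def IsIntSyzygy (R : Type u) [CommRing R] (n : ℤ) (M N : Type u) [AddCommGroup M] [Module R M]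
    [AddCommGroup N] [Module R N] : Prop :=
  match n with
  | Int.ofNat k => IsNthSyzygy R k (ModuleCat.of R M) (ModuleCat.of R N)
  | Int.negSucc k => IsNthSyzygy R (k + 1) (ModuleCat.of R N) (ModuleCat.of R M)

/-- The assertion of the Auslander–Reiten conjecture for the module `M` over `R`: if
`Ext^i_R(M, M ⊕ R) = 0` for all `i > 0`, then `M` is projective. -/
def AuslanderReitenHolds (R : Type u) [CommRing R] (M : Type u) [AddCommGroup M]
    [Module R M] : Prop :=
  (∀ i : ℕ, 0 < i →
    Subsingleton (CategoryTheory.Abelian.Ext.{u} (ModuleCat.of R M) (ModuleCat.of R (M × R)) i)) →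
  Module.Projective R M

open CategoryTheory Abelian

/-! ### Lifting and extending linear maps when `Ext¹` vanishes -/

section ExtModule

variable {R : Type u} [CommRing R]

/-- The short complex of modules attached to an exact pair of linear maps. -/
abbrev shortComplexOfExact {A B C : Type u} [AddCommGroup A] [Module R A] [AddCommGroup B]
    [Module R B] [AddCommGroup C] [Module R C] {f : A →ₗ[R] B} {g : B →ₗ[R] C}
    (h : Function.Exact f g) : ShortComplex (ModuleCat.{u} R) :=
  ModuleCat.shortComplexOfCompEqZero f g h.linearMap_comp_eq_zero

lemma shortExact_shortComplexOfExact {A B C : Type u} [AddCommGroup A] [Module R A]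
    [AddCommGroup B] [Module R B] [AddCommGroup C] [Module R C] {f : A →ₗ[R] B} {g : B →ₗ[R] C}
    (hf : Function.Injective f) (h : Function.Exact f g) (hg : Function.Surjective g) :
    (shortComplexOfExact h).ShortExact :=
  ModuleCat.shortComplex_shortExact _ h hf hg

lemma subsingleton_ext_of_iso_left {X X' Y : ModuleCat.{u} R} (e : X ≅ X') (n : ℕ)
    [Subsingleton (Ext.{u} X Y n)] : Subsingleton (Ext.{u} X' Y n) := by
  refine subsingleton_of_forall_eq 0 fun x ↦ ?_
  have h : (Ext.mk₀ e.hom).comp x (zero_add n) = 0 := Subsingleton.elim _ _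
  have h' := congrArg (fun y ↦ (Ext.mk₀ e.inv).comp y (zero_add n)) h
  simpa using h'

lemma subsingleton_ext_of_retract_right {X Y Y' : ModuleCat.{u} R} (e : Retract Y' Y) (n : ℕ)
    [Subsingleton (Ext.{u} X Y n)] : Subsingleton (Ext.{u} X Y' n) := by
  refine subsingleton_of_forall_eq 0 fun x ↦ ?_
  rw [← x.comp_mk₀_id, ← e.retract, ← Ext.mk₀_comp_mk₀, ← Ext.comp_assoc_of_second_deg_zero,
    Subsingleton.elim (x.comp (Ext.mk₀ e.i) (add_zero n)) 0, Ext.zero_comp]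

/-- A linear map into `C` lifts along a surjection `B → C` with kernel `A` when `Ext¹(X, A) = 0`. -/
lemma exists_comp_eq_of_subsingleton_ext {A B C X : Type u} [AddCommGroup A] [Module R A]
    [AddCommGroup B] [Module R B] [AddCommGroup C] [Module R C] [AddCommGroup X] [Module R X]
    {f : A →ₗ[R] B} {g : B →ₗ[R] C}
    (hf : Function.Injective f) (h : Function.Exact f g) (hg : Function.Surjective g)
    [Subsingleton (Ext.{u} (ModuleCat.of R X) (ModuleCat.of R A) 1)] (φ : X →ₗ[R] C) :
    ∃ ψ : X →ₗ[R] B, g ∘ₗ ψ = φ := by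
  obtain ⟨x, hx⟩ := Ext.covariant_sequence_exact₃ (ModuleCat.of R X)
    (shortExact_shortComplexOfExact hf h hg) (Ext.mk₀ (ModuleCat.ofHom φ)) (zero_add 1)
    (Subsingleton.elim (α := Ext.{u} (ModuleCat.of R X) (ModuleCat.of R A) 1) _ _)
  obtain ⟨ψ, rfl⟩ := Ext.homEquiv₀.symm.surjective x
  refine ⟨ψ.hom, ?_⟩
  have : ψ ≫ ModuleCat.ofHom g = ModuleCat.ofHom φ :=
    Ext.homEquiv₀.symm.injective (by simpa using hx)
  exact congrArg ModuleCat.Hom.hom this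

/-- A linear map from `A` extends along an injection `A → B` with cokernel `C` when
`Ext¹(C, Y) = 0`. -/
lemma exists_comp_eq_of_subsingleton_ext' {A B C Y : Type u} [AddCommGroup A] [Module R A]
    [AddCommGroup B] [Module R B] [AddCommGroup C] [Module R C] [AddCommGroup Y] [Module R Y]
    {f : A →ₗ[R] B} {g : B →ₗ[R] C}
    (hf : Function.Injective f) (h : Function.Exact f g) (hg : Function.Surjective g)
    [Subsingleton (Ext.{u} (ModuleCat.of R C) (ModuleCat.of R Y) 1)] (φ : A →ₗ[R] Y) :
    ∃ ψ : B →ₗ[R] Y, ψ ∘ₗ f = φ := by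
  obtain ⟨x, hx⟩ := Ext.contravariant_sequence_exact₁ (shortExact_shortComplexOfExact hf h hg)
    (ModuleCat.of R Y) (Ext.mk₀ (ModuleCat.ofHom φ)) (add_zero 1)
    (Subsingleton.elim (α := Ext.{u} (ModuleCat.of R C) (ModuleCat.of R Y) 1) _ _)
  obtain ⟨ψ, rfl⟩ := Ext.homEquiv₀.symm.surjective x
  refine ⟨ψ.hom, ?_⟩
  have : ModuleCat.ofHom f ≫ ψ = ModuleCat.ofHom φ :=
    Ext.homEquiv₀.symm.injective (by simpa using hx)
  exact congrArg ModuleCat.Hom.hom this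

end ExtModule

/-! ### Self-injectivity of Artinian Gorenstein local rings -/

section SelfInjective

variable {R : Type u} [CommRing R]

lemma nonempty_linearEquiv_quotient_maximalIdeal [IsLocalRing R] (S : Type*) [AddCommGroup S]
    [Module R S] [IsSimpleModule R S] :
    Nonempty (S ≃ₗ[R] R ⧸ IsLocalRing.maximalIdeal R) := by
  obtain ⟨m, hm, ⟨e⟩⟩ := isSimpleModule_iff_quot_maximal (R := R).mp ‹IsSimpleModule R S›
  rw [IsLocalRing.eq_maximalIdeal hm] at e
  exact ⟨e⟩

lemma exists_simple_submodule (R M : Type*) [Ring R] [AddCommGroup M] [Module R M]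
    [IsArtinian R M] [Nontrivial M] : ∃ S : Submodule R M, IsSimpleModule R S := by
  obtain ⟨S, hS⟩ := IsAtomic.exists_atom (Submodule R M)
  exact ⟨S, isSimpleModule_iff_isAtom.mpr hS⟩

lemma exists_simple_quotient (R M : Type*) [Ring R] [AddCommGroup M] [Module R M]
    [Module.Finite R M] [Nontrivial M] : ∃ N : Submodule R M, IsSimpleModule R (M ⧸ N) := by
  obtain ⟨N, hN⟩ := IsCoatomic.exists_coatom (Submodule R M)
  exact ⟨N, isSimpleModule_iff_isCoatom.mpr hN⟩

/-- Over an Artinian local ring there is a nonzero map from any nonzero finite module to any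
nonzero finite module. -/
lemma exists_linearMap_ne_zero [IsArtinianRing R] [IsLocalRing R] (M N : Type*) [AddCommGroup M]
    [Module R M] [AddCommGroup N] [Module R N] [Module.Finite R M] [Module.Finite R N]
    [Nontrivial M] [Nontrivial N] : ∃ φ : M →ₗ[R] N, φ ≠ 0 := by
  obtain ⟨K, hK⟩ := exists_simple_quotient R M
  obtain ⟨S, hS⟩ := exists_simple_submodule R N
  obtain ⟨e⟩ := nonempty_linearEquiv_quotient_maximalIdeal (R := R) (M ⧸ K)
  obtain ⟨e'⟩ := nonempty_linearEquiv_quotient_maximalIdeal (R := R) S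
  -- Send a simple quotient of `M` onto a simple submodule of `N`; both are copies of the residue
  -- field.
  refine ⟨S.subtype ∘ₗ (e.trans e'.symm).toLinearMap ∘ₗ K.mkQ, fun h ↦ ?_⟩
  have := IsSimpleModule.nontrivial R S
  obtain ⟨s, hs⟩ := exists_ne (0 : S)
  obtain ⟨x, hx⟩ := ((e.trans e'.symm).surjective.comp K.mkQ_surjective) s
  have h' := LinearMap.congr_fun h x
  refine hs (Subtype.ext ?_)
  rw [← hx]
  exact h'

/-- The residue field embeds in `R` as a simple ideal `S`. So `Ext^(i+1)(S, R)` is squeezed between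
`Ext^(i+1)(R, R) = 0` and `Ext^(i+2)(R ⧸ S, R) = 0`, and dévissage gives all finite modules. -/
lemma subsingleton_ext_self_of_succ [IsArtinianRing R] [IsLocalRing R] (i : ℕ)
    (H : ∀ (X : Type u) [AddCommGroup X] [Module R X] [Module.Finite R X],
      Subsingleton (Ext.{u} (ModuleCat.of R X) (ModuleCat.of R R) (i + 2)))
    (X : Type u) [AddCommGroup X] [Module R X] [hX : Module.Finite R X] :
    Subsingleton (Ext.{u} (ModuleCat.of R X) (ModuleCat.of R R) (i + 1)) := by
  obtain ⟨S, hS⟩ := exists_simple_submodule R R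
  obtain ⟨e⟩ := nonempty_linearEquiv_quotient_maximalIdeal (R := R) S
  have hSext : Subsingleton (Ext.{u} (ModuleCat.of R S) (ModuleCat.of R R) (i + 1)) := by
    refine subsingleton_of_forall_eq 0 fun x ↦ ?_
    have hproj : Projective (ModuleCat.of R R) :=
      (IsProjective.iff_projective R).mp inferInstance
    have := H (R ⧸ S)
    obtain ⟨y, rfl⟩ := Ext.contravariant_sequence_exact₁
      (shortExact_shortComplexOfExact (R := R) S.injective_subtype
        (LinearMap.exact_subtype_mkQ S) S.mkQ_surjective) _ x (n₁ := i + 2) (by lia)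
      (Subsingleton.elim (α := Ext.{u} (ModuleCat.of R (R ⧸ S)) (ModuleCat.of R R) (i + 2)) _ _)
    have hy : y = 0 := Ext.eq_zero_of_projective (P := ModuleCat.of R R) y
    rw [hy, Ext.comp_zero]
  induction hX using IsNoetherianRing.induction_on_isQuotientEquivQuotientPrime R with
  | subsingleton N =>
    refine subsingleton_of_forall_eq 0 fun x ↦ ?_
    rw [← x.mk₀_id_comp, (ModuleCat.isZero_of_subsingleton (ModuleCat.of R N)).eq_zero_of_src (𝟙 _),
      Ext.mk₀_zero, Ext.zero_comp]
  | quotient N p f =>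
    have hp : p.1 = IsLocalRing.maximalIdeal R :=
      IsLocalRing.eq_maximalIdeal inferInstance
    rw [hp] at f
    exact subsingleton_ext_of_iso_left (e.trans f.symm).toModuleIso _
  | exact A B C f g hf hg h hA hC =>
    refine subsingleton_of_forall_eq 0 fun x ↦ ?_
    obtain ⟨y, rfl⟩ := Ext.contravariant_sequence_exact₂ (shortExact_shortComplexOfExact hf h hg)
      _ x (Subsingleton.elim (α := Ext.{u} (ModuleCat.of R A) (ModuleCat.of R R) (i + 1)) _ _)
    have hy : y = 0 :=
      Subsingleton.elim (α := Ext.{u} (ModuleCat.of R C) (ModuleCat.of R R) (i + 1)) _ _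
    rw [hy, Ext.comp_zero]

/-- An Artinian Gorenstein local ring is self-injective. -/
theorem injective_self_of_isGorensteinLocalRing [IsArtinianRing R] [IsGorensteinLocalRing R] :
    Module.Injective R R := by
  obtain ⟨d, hd⟩ := IsGorensteinLocalRing.exists_hasInjectiveDimensionLE (R := R)
  -- Descending induction on the degree: `k` bounds how far `i` lies below `d`.
  have key (k : ℕ) : ∀ i : ℕ, d ≤ i + k → ∀ (X : Type u) [AddCommGroup X] [Module R X]
      [Module.Finite R X],
      Subsingleton (Ext.{u} (ModuleCat.of R X) (ModuleCat.of R R) (i + 1)) := by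
    induction k with
    | zero =>
      intro i hi X _ _ _
      exact HasInjectiveDimensionLT.subsingleton (ModuleCat.of R R) (d + 1) (i + 1) (by lia) _
    | succ k ih =>
      intro i hi X _ _ _
      exact subsingleton_ext_self_of_succ i (ih (i + 1) (by lia)) X
  refine Module.Baer.injective fun J φ ↦ ?_
  have := key d 0 (by lia) (R ⧸ J)
  obtain ⟨ψ, hψ⟩ := exists_comp_eq_of_subsingleton_ext' (R := R) J.injective_subtype
    (LinearMap.exact_subtype_mkQ J) J.mkQ_surjective φ
  exact ⟨ψ, fun x hx ↦ LinearMap.congr_fun hψ ⟨x, hx⟩⟩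

end SelfInjective

/-! ### Rigid ideals and invariance under syzygies -/

section Rigid

variable {R : Type u} [CommRing R]

/-- Over a self-injective Artinian local ring, a rigid ideal is trivial. -/
theorem eq_bot_or_eq_top_of_isRigidModule [IsArtinianRing R] [IsLocalRing R]
    [Module.Injective R R] (I : Ideal R) (hI : IsRigidModule R I) : I = ⊥ ∨ I = ⊤ := by
  by_contra! hne
  have : Nontrivial I := Submodule.nontrivial_iff_ne_bot.mpr hne.1
  have : Nontrivial (R ⧸ I) := Ideal.Quotient.nontrivial_iff.mpr hne.2
  obtain ⟨φ, hφ⟩ := exists_linearMap_ne_zero (R := R) I (R ⧸ I)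
  have : Subsingleton (Ext.{u} (ModuleCat.of R I) (ModuleCat.of R I) 1) := hI
  obtain ⟨ψ, rfl⟩ := exists_comp_eq_of_subsingleton_ext (R := R) I.injective_subtype
    (LinearMap.exact_subtype_mkQ I) I.mkQ_surjective φ
  -- Extended to `χ : R → R`, the lift `ψ` becomes multiplication by `χ 1`.
  obtain ⟨χ, hχ⟩ := Module.Injective.out I.subtype I.injective_subtype ψ
  refine hφ (LinearMap.ext fun x ↦ ?_)
  have hx : ψ x = (x : R) * χ 1 := by
    rw [← hχ, ← smul_eq_mul, ← map_smul, smul_eq_mul, mul_one]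
    rfl
  simp only [LinearMap.comp_apply, LinearMap.zero_apply, Submodule.mkQ_apply, hx]
  exact (Submodule.Quotient.mk_eq_zero I).mpr (I.mul_mem_right _ x.2)

variable {M N : Type u} [AddCommGroup M] [Module R M] [AddCommGroup N] [Module R N]

lemma IsFirstSyzygy.finite_left [IsNoetherianRing R] (h : IsFirstSyzygy R M N) :
    Module.Finite R M := by
  obtain ⟨m, f, g, hf, -, -⟩ := h
  exact Module.Finite.of_injective f hf

lemma IsFirstSyzygy.finite_right (h : IsFirstSyzygy R M N) : Module.Finite R N := by
  obtain ⟨m, f, g, -, -, hg⟩ := h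
  exact Module.Finite.of_surjective g hg

/-- Rigidity is invariant under taking syzygies over a self-injective ring. -/
theorem IsFirstSyzygy.isRigidModule_iff [Module.Injective R R] (h : IsFirstSyzygy R M N) :
    IsRigidModule R M ↔ IsRigidModule R N := by
  obtain ⟨m, f, g, hf, h, hg⟩ := h
  have hS := shortExact_shortComplexOfExact hf h hg
  have : Module.Injective R (Fin m → R) := inferInstance
  have hinj : Injective (ModuleCat.of R (Fin m → R)) :=
    (Module.injective_iff_injective_object R _).mp this
  have hproj : Projective (ModuleCat.of R (Fin m → R)) :=
    (IsProjective.iff_projective _).mp inferInstance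
  constructor
  · intro hM
    have : Subsingleton (Ext.{u} (ModuleCat.of R M) (ModuleCat.of R M) 1) := hM
    refine subsingleton_of_forall_eq 0 fun x ↦ ?_
    -- The image of `x` in `Ext²(N, M)` comes from `Ext¹(M, M) = 0`, so `x` comes from `Ext¹(N, F) =
    -- 0`, with `F` the free middle term.
    obtain ⟨y, hy⟩ := Ext.contravariant_sequence_exact₃ hS (ModuleCat.of R M)
      (n₁ := 2) (x.comp hS.extClass rfl)
      (Ext.eq_zero_of_projective (P := ModuleCat.of R (Fin m → R)) _) (n₀ := 1) rfl
    have hy0 : y = 0 :=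
      Subsingleton.elim (α := Ext.{u} (ModuleCat.of R M) (ModuleCat.of R M) 1) _ _
    rw [hy0, Ext.comp_zero] at hy
    obtain ⟨z, rfl⟩ := Ext.covariant_sequence_exact₃ (ModuleCat.of R N) hS x rfl hy.symm
    have hz : z = 0 := Ext.eq_zero_of_injective (I := ModuleCat.of R (Fin m → R)) z
    rw [hz, Ext.zero_comp]
  · intro hN
    have : Subsingleton (Ext.{u} (ModuleCat.of R N) (ModuleCat.of R N) 1) := hN
    refine subsingleton_of_forall_eq 0 fun x ↦ ?_
    -- Dually, the image of `x` in `Ext²(N, M)` comes from `Ext¹(N, N) = 0`, so `x` comes from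
    -- `Ext¹(F, M) = 0`.
    obtain ⟨y, hy⟩ := Ext.covariant_sequence_exact₁ (ModuleCat.of R N) hS
      (n₁ := 2) (hS.extClass.comp x rfl)
      (Ext.eq_zero_of_injective (I := ModuleCat.of R (Fin m → R)) _) (n₀ := 1) rfl
    have hy0 : y = 0 :=
      Subsingleton.elim (α := Ext.{u} (ModuleCat.of R N) (ModuleCat.of R N) 1) _ _
    rw [hy0, Ext.zero_comp] at hy
    obtain ⟨z, rfl⟩ := Ext.contravariant_sequence_exact₁ hS (ModuleCat.of R M) x rfl hy.symm
    have hz : z = 0 := Ext.eq_zero_of_projective (P := ModuleCat.of R (Fin m → R)) z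
    rw [hz, Ext.comp_zero]

/-- Freeness is invariant under taking syzygies over a self-injective Noetherian local ring. -/
theorem IsFirstSyzygy.free_iff [IsNoetherianRing R] [IsLocalRing R] [Module.Injective R R]
    (h : IsFirstSyzygy R M N) : Module.Free R M ↔ Module.Free R N := by
  have := h.finite_left
  have := h.finite_right
  obtain ⟨m, f, g, hf, h, hg⟩ := h
  constructor
  · intro hM
    -- A finite free `M` is a finite power of `R`, hence injective, so `f` splits.
    have : Module.Injective R M := by
      have e := Module.finBasis R M |>.equivFun
      exact Module.Injective.of_ringEquiv (RingEquiv.refl R) e.symm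
    obtain ⟨l, hl⟩ := Module.Injective.out f hf (LinearMap.id : M →ₗ[R] M)
    obtain ⟨s, hs⟩ := (((h.split_tfae').out 1 0 rfl rfl).mp
      ⟨hg, l, LinearMap.ext hl⟩ : Function.Injective f ∧ ∃ s, g ∘ₗ s = LinearMap.id).2
    have := Module.Projective.of_split s g hs
    exact Module.free_of_flat_of_isLocalRing
  · intro hN
    obtain ⟨s, hs⟩ := Module.projective_lifting_property g LinearMap.id hg
    obtain ⟨l, hl⟩ := (((h.split_tfae').out 0 1 rfl rfl).mp
      ⟨hf, s, hs⟩ : Function.Surjective g ∧ ∃ l, l ∘ₗ f = LinearMap.id).2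
    have := Module.Projective.of_split f l hl
    exact Module.free_of_flat_of_isLocalRing

/-- Over a self-injective Noetherian local ring, rigidity and freeness are invariant under
taking higher syzygies. -/
theorem IsNthSyzygy.isRigidModule_iff_and_free_iff [IsNoetherianRing R] [IsLocalRing R]
    [Module.Injective R R] (n : ℕ) (M N : ModuleCat.{u} R) (h : IsNthSyzygy R n M N) :
    (IsRigidModule R M ↔ IsRigidModule R N) ∧ (Module.Free R M ↔ Module.Free R N) := by
  induction n generalizing M with
  | zero =>
    obtain ⟨e⟩ := h
    have aux {A B : ModuleCat.{u} R} (e : A ≅ B) (hA : IsRigidModule R A) :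
        IsRigidModule R B := by
      have : Subsingleton (Ext.{u} A A 1) := hA
      have : Subsingleton (Ext.{u} B A 1) := subsingleton_ext_of_iso_left e 1
      exact subsingleton_ext_of_retract_right e.symm.retract 1
    exact ⟨⟨aux e.toModuleIso, aux e.symm.toModuleIso⟩,
      fun _ ↦ Module.Free.of_equiv e, fun _ ↦ Module.Free.of_equiv e.symm⟩
  | succ n ih =>
    obtain ⟨K, hK, hn⟩ := h
    exact ⟨hK.isRigidModule_iff.trans (ih K hn).1, hK.free_iff.trans (ih K hn).2⟩

theorem free_of_isRigidModule_ideal [IsArtinianRing R] [IsLocalRing R]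
    [Module.Injective R R] (I : Ideal R) (hI : IsRigidModule R I) : Module.Free R I := by
  rcases eq_bot_or_eq_top_of_isRigidModule I hI with rfl | rfl
  · infer_instance
  · exact Module.Free.of_equiv (Submodule.topEquiv (R := R) (M := R)).symm

end Rigid

theorem mainTheorem2 (R : Type u) [CommRing R] [IsArtinianRing R] [IsGorensteinLocalRing R] :
    (∀ (M : Type u) [AddCommGroup M] [Module R M] (I : Ideal R) (n : ℤ),
      IsIntSyzygy R n M I → IsRigidModule R M → Module.Free R M) ∧
    (∀ I : Ideal R, AuslanderReitenHolds R I) := by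
  have : Module.Injective R R := injective_self_of_isGorensteinLocalRing
  refine ⟨fun M _ _ I n h hM ↦ ?_, fun I h ↦ ?_⟩
  · cases n with
    | ofNat k =>
      obtain ⟨h₁, h₂⟩ := IsNthSyzygy.isRigidModule_iff_and_free_iff k _ _ h
      exact h₂.mpr (free_of_isRigidModule_ideal I (h₁.mp hM))
    | negSucc k =>
      obtain ⟨h₁, h₂⟩ := IsNthSyzygy.isRigidModule_iff_and_free_iff (k + 1) _ _ h
      exact h₂.mp (free_of_isRigidModule_ideal I (h₁.mpr hM))
  -- Only degree 1 and the summand `I` of `I × R` are needed.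
  · have := h 1 one_pos
    have hI : IsRigidModule R I := subsingleton_ext_of_retract_right
      (Y := ModuleCat.of R (I × R)) (Y' := ModuleCat.of R I)
      { i := ModuleCat.ofHom (LinearMap.inl R I R)
        r := ModuleCat.ofHom (LinearMap.fst R I R)
        retract := ModuleCat.hom_ext (LinearMap.fst_comp_inl R I R) } 1
    have := free_of_isRigidModule_ideal I hI
    infer_instance
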